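/- Let $G=(V,E)$ be a (simple, possibly infinite, not necessarily locally finite) graph. An end of $G$ is an equivalence class of rays (one-way infinite paths) of $G$, two rays being equivalent if no finite set of vertices separates them. Let $|G|$ be the topological space whose points are the vertices of $G$, the inner points of its edges (each edge being a copy of $[0,1]$) and the ends of $G$, with the following basic open neighbourhoods: for an inner point of an edge, the open subintervals of that edge around it; for a vertex $v$, the sets consisting of $v$ and, for some $\varepsilon>0$, a half-open interval of length $\varepsilon$ at $v$ on each edge at $v$; for an end $\omega$, the sets given by a finite $S\subseteq V$ and $\varepsilon>0$ that consist of the component $C$ of $G-S$ in which the rays of $\omega$ have tails (vertices and edges), all ends with a ray in $C$, and, for each $S$–$C$ edge, its inner points at distance less than $\varepsilon$ from its endpoint in $C$. A standard subspace of $|G|$ is a closed subset $X\subseteq|G|$ that contains every edge (with its endpoints) of which it contains an inner point. For a finite $S\subseteq V$, $X-S$ is obtained from $X$ by deleting the vertices in $S$ together with the interiors of all edges incident with them. A standard subspace $X$ is weakly $k$-connected if it contains at least $k+1$ vertices of $G$ and $X-S$ is path-connected for every $S\subseteq V$ with $|S|<k$. The degree of a vertex $v$ in $X$ is the number of edges of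 $G$ that are incident with $v$ and contained in $X$. The interior (set of inner points) of an edge $e$ is denoted by $\mathring e$. **Theorem.** Let $k\ge 2$ be an integer, let $G$ be a graph, and let $X$ be a weakly $k$-connected standard subspace of $|G|$. Let $C$ be a finite cycle in $G$ such that, for every edge $e$ of $C$, the space $X\setminus\mathring e$ is not weakly $k$-connected. Then $C$ contains a vertex of degree $k$ in $X$. -/

import Mathlib

namespace GraphSpace

variable {V : Type*}

/-- `u` and `v` lie in the same component of `G - S`: they are joined by a walk avoiding `S`. -/
def JoinedOff (G : SimpleGraph V) (S : Finset V) (u v : V) : Prop :=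
  ∃ w : G.Walk u v, ∀ x ∈ w.support, x ∉ S

theorem JoinedOff.symm {G : SimpleGraph V} {S : Finset V} {u v : V}
    (h : JoinedOff G S u v) : JoinedOff G S v u := by
  obtain ⟨w, hw⟩ := h
  exact ⟨w.reverse, fun x hx => hw x (by simpa using hx)⟩

theorem JoinedOff.trans {G : SimpleGraph V} {S : Finset V} {u v x : V}
    (h : JoinedOff G S u v) (h' : JoinedOff G S v x) : JoinedOff G S u x := by
  obtain ⟨w, hw⟩ := h
  obtain ⟨w', hw'⟩ := h'
  refine ⟨w.append w', fun y hy => ?_⟩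
  rcases (SimpleGraph.Walk.mem_support_append_iff w w').1 hy with hy | hy
  · exact hw y hy
  · exact hw' y hy

theorem JoinedOff.mono {G : SimpleGraph V} {S T : Finset V} (hST : S ⊆ T) {u v : V}
    (h : JoinedOff G T u v) : JoinedOff G S u v := by
  obtain ⟨w, hw⟩ := h
  exact ⟨w, fun x hx hS => hw x hx (hST hS)⟩

theorem JoinedOff.notMem_right {G : SimpleGraph V} {S : Finset V} {u v : V}
    (h : JoinedOff G S u v) : v ∉ S := by
  obtain ⟨w, hw⟩ := h
  exact hw v w.end_mem_support

theorem JoinedOff.of_adj {G : SimpleGraph V} {S : Finset V} {u v : V}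
    (h : G.Adj u v) (hu : u ∉ S) (hv : v ∉ S) : JoinedOff G S u v := by
  refine ⟨h.toWalk, fun x hx => ?_⟩
  have hx' : x = u ∨ x = v := by simpa using hx
  rcases hx' with rfl | rfl
  · exact hu
  · exact hv

/-- A ray of `G`: a one-way infinite path. -/
structure Ray (G : SimpleGraph V) where
  vert : ℕ → V
  injective : Function.Injective vert
  adj : ∀ n, G.Adj (vert n) (vert (n + 1))

theorem Ray.eventually_notMem {G : SimpleGraph V} (r : Ray G) (S : Finset V) :
    ∃ N, ∀ n ≥ N, r.vert n ∉ S := by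
  have hfin : (r.vert ⁻¹' (S : Set V)).Finite := S.finite_toSet.preimage r.injective.injOn
  obtain ⟨N, hN⟩ := hfin.bddAbove
  refine ⟨N + 1, fun n hn hS => ?_⟩
  have : n ≤ N := hN hS
  omega

theorem Ray.joinedOff_tail {G : SimpleGraph V} (r : Ray G) (S : Finset V) :
    ∃ N, ∀ m ≥ N, ∀ n ≥ N, JoinedOff G S (r.vert m) (r.vert n) := by
  obtain ⟨N, hN⟩ := r.eventually_notMem S
  have key : ∀ n ≥ N, JoinedOff G S (r.vert N) (r.vert n) := by
    intro n hn
    induction n, hn using Nat.le_induction with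
    | base =>
      refine ⟨SimpleGraph.Walk.nil, fun x hx => ?_⟩
      have hx' : x = r.vert N := by simpa using hx
      rw [hx']
      exact hN N le_rfl
    | succ n hn ih =>
      exact ih.trans (JoinedOff.of_adj (r.adj n) (hN n hn) (hN (n + 1) (by omega)))
  exact ⟨N, fun m hm n hn => (key m hm).symm.trans (key n hn)⟩

/-- Two rays are equivalent if no finite set of vertices separates them: for every finite `S`
they have tails in the same component of `G - S`. -/
def Ray.Equivalent {G : SimpleGraph V} (r r' : Ray G) : Prop :=
  ∀ S : Finset V, ∃ N, ∀ m ≥ N, ∀ n ≥ N, JoinedOff G S (r.vert m) (r'.vert n)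

instance raySetoid (G : SimpleGraph V) : Setoid (Ray G) where
  r := Ray.Equivalent
  iseqv :=
    { refl := fun r S => r.joinedOff_tail S
      symm := fun h S => by
        obtain ⟨N, hN⟩ := h S
        exact ⟨N, fun m hm n hn => (hN n hn m hm).symm⟩
      trans := fun h h' S => by
        obtain ⟨N, hN⟩ := h S
        obtain ⟨N', hN'⟩ := h' S
        refine ⟨max N N', fun m hm n hn => ?_⟩
        exact (hN m (le_trans (le_max_left _ _) hm) (max N N') (le_max_left _ _)).trans
          (hN' (max N N') (le_max_right _ _) n (le_trans (le_max_right _ _) hn)) }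

/-- The ends of `G`: the equivalence classes of its rays. -/
def End (G : SimpleGraph V) : Type _ := Quotient (raySetoid G)

/-- The end that contains a given ray. -/
def Ray.toEnd {G : SimpleGraph V} (r : Ray G) : End G := Quotient.mk (raySetoid G) r

/-- The vertex set of the component of `G - S` in which the rays of `ω` have tails. -/
def endComp {G : SimpleGraph V} (S : Finset V) (ω : End G) : Set V :=
  {v | ∃ r : Ray G, r.toEnd = ω ∧ ∃ N, ∀ n ≥ N, JoinedOff G S (r.vert n) v}

theorem endComp_mono {G : SimpleGraph V} {S T : Finset V} (hST : S ⊆ T) (ω : End G) :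
    endComp T ω ⊆ endComp S ω := by
  rintro v ⟨r, hr, N, hN⟩
  exact ⟨r, hr, N, fun n hn => (hN n hn).mono hST⟩

theorem notMem_of_mem_endComp {G : SimpleGraph V} {S : Finset V} {ω : End G} {v : V}
    (hv : v ∈ endComp S ω) : v ∉ S := by
  obtain ⟨r, -, N, hN⟩ := hv
  exact (hN N le_rfl).notMem_right

theorem mem_endComp_of_adj {G : SimpleGraph V} {S : Finset V} {ω : End G} {v u : V}
    (hv : v ∈ endComp S ω) (h : G.Adj v u) (hu : u ∉ S) : u ∈ endComp S ω := by
  have hvS := notMem_of_mem_endComp hv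
  obtain ⟨r, hr, N, hN⟩ := hv
  exact ⟨r, hr, N, fun n hn => (hN n hn).trans (JoinedOff.of_adj h hvS hu)⟩

/-- The points of `|G|`: the vertices, the inner points of the edges, and the ends. The interior
of each edge `e` is a copy of the open interval `(0, 1)`, with `t` tending to `0` at the endpoint
`(Quot.out e.1).1` of `e` (an arbitrarily fixed one of the two) and to `1` at the other one. -/
inductive Point (G : SimpleGraph V) where
  | vertex (v : V)
  | inner (e : G.edgeSet) (t : Set.Ioo (0 : ℝ) 1)
  | ofEnd (ω : End G)

open Classical in
/-- The distance, along the edge `e`, of the inner point `t` of `e` from the endpoint `v` of `e`. -/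
noncomputable def distTo {G : SimpleGraph V} (e : G.edgeSet) (t : Set.Ioo (0 : ℝ) 1) (v : V) : ℝ :=
  if v = (Quot.out e.1).1 then t.1 else 1 - t.1

/-- The basic open neighbourhoods of a vertex `v`: `v` together with half-open edges at `v`
of length `ε`. -/
def vertexNhd (G : SimpleGraph V) (ε : ℝ) (v : V) : Set (Point G) :=
  {p | p = Point.vertex v ∨
    ∃ (e : G.edgeSet) (t : Set.Ioo (0 : ℝ) 1), p = Point.inner e t ∧ v ∈ e.1 ∧ distTo e t v < ε}

/-- The basic open neighbourhoods of an inner point of an edge: open subintervals of the edge. -/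
def innerNhd {G : SimpleGraph V} (ε : ℝ) (e : G.edgeSet) (t : Set.Ioo (0 : ℝ) 1) :
    Set (Point G) :=
  {p | ∃ t' : Set.Ioo (0 : ℝ) 1, p = Point.inner e t' ∧ |t'.1 - t.1| < ε}

/-- The basic open neighbourhoods of an end `ω`. With `C` the component of `G - S` containing
tails of the rays of `ω`, such a neighbourhood consists of the vertices of `C`, the inner points
of the edges of `C`, the inner points of the `S`-`C` edges at distance less than `ε` from their
endpoint in `C`, and the ends that have a ray in `C`. -/
def endNhd {G : SimpleGraph V} (S : Finset V) (ε : ℝ) (ω : End G) : Set (Point G) :=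
  {p | match p with
    | Point.vertex v => v ∈ endComp S ω
    | Point.inner e t => (∀ v ∈ e.1, v ∈ endComp S ω) ∨
        ∃ s ∈ S, ∃ v ∈ endComp S ω, e.1 = s(s, v) ∧ distTo e t v < ε
    | Point.ofEnd ω' => ∃ r : Ray G, r.toEnd = ω' ∧ ∀ n, r.vert n ∈ endComp S ω}

theorem vertexNhd_mono {G : SimpleGraph V} {ε δ : ℝ} (h : ε ≤ δ) (v : V) :
    vertexNhd G ε v ⊆ vertexNhd G δ v := by
  rintro p (hp | ⟨e, t, hp, hv, hd⟩)
  · exact Or.inl hp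
  · exact Or.inr ⟨e, t, hp, hv, lt_of_lt_of_le hd h⟩

theorem innerNhd_mono {G : SimpleGraph V} {ε δ : ℝ} (h : ε ≤ δ) (e : G.edgeSet)
    (t : Set.Ioo (0 : ℝ) 1) : innerNhd ε e t ⊆ innerNhd δ e t := by
  rintro p ⟨t', hp, hd⟩
  exact ⟨t', hp, lt_of_lt_of_le hd h⟩

theorem endNhd_mono {G : SimpleGraph V} {S T : Finset V} (hST : S ⊆ T) {ε δ : ℝ} (h : ε ≤ δ)
    (ω : End G) : endNhd T ε ω ⊆ endNhd S δ ω := by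
  rintro (v | ⟨e, t⟩ | ω') hp
  · exact endComp_mono hST ω hp
  · rcases hp with hp | ⟨s, _, v, hv, he, hd⟩
    · exact Or.inl fun v hv => endComp_mono hST ω (hp v hv)
    · have hv' := endComp_mono hST ω hv
      by_cases hsS : s ∈ S
      · exact Or.inr ⟨s, hsS, v, hv', he, lt_of_lt_of_le hd h⟩
      · have hadj : G.Adj s v := by
          have := e.2
          rw [he] at this
          exact this
        refine Or.inl fun x hx => ?_
        rw [he, Sym2.mem_iff] at hx
        rcases hx with rfl | rfl
        · exact mem_endComp_of_adj hv' hadj.symm hsS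
        · exact hv'
  · obtain ⟨r, hr, hC⟩ := hp
    exact ⟨r, hr, fun n => endComp_mono hST ω (hC n)⟩

/-- The topology of `|G|`: a set is open if it contains a basic open neighbourhood of each of
its points. -/
instance (G : SimpleGraph V) : TopologicalSpace (Point G) where
  IsOpen U :=
    (∀ v, Point.vertex v ∈ U → ∃ ε > 0, vertexNhd G ε v ⊆ U) ∧
    (∀ e t, Point.inner e t ∈ U → ∃ ε > 0, innerNhd ε e t ⊆ U) ∧
    (∀ ω, Point.ofEnd ω ∈ U → ∃ S : Finset V, ∃ ε > 0, endNhd S ε ω ⊆ U)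
  isOpen_univ :=
    ⟨fun _ _ => ⟨1, one_pos, Set.subset_univ _⟩, fun _ _ _ => ⟨1, one_pos, Set.subset_univ _⟩,
      fun _ _ => ⟨∅, 1, one_pos, Set.subset_univ _⟩⟩
  isOpen_inter := by
    classical
    rintro U W ⟨hU1, hU2, hU3⟩ ⟨hW1, hW2, hW3⟩
    refine ⟨fun v hv => ?_, fun e t ht => ?_, fun ω hω => ?_⟩
    · obtain ⟨ε, hε, h⟩ := hU1 v hv.1
      obtain ⟨δ, hδ, h'⟩ := hW1 v hv.2
      exact ⟨min ε δ, lt_min hε hδ, Set.subset_inter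
        ((vertexNhd_mono (min_le_left _ _) v).trans h)
        ((vertexNhd_mono (min_le_right _ _) v).trans h')⟩
    · obtain ⟨ε, hε, h⟩ := hU2 e t ht.1
      obtain ⟨δ, hδ, h'⟩ := hW2 e t ht.2
      exact ⟨min ε δ, lt_min hε hδ, Set.subset_inter
        ((innerNhd_mono (min_le_left _ _) e t).trans h)
        ((innerNhd_mono (min_le_right _ _) e t).trans h')⟩
    · obtain ⟨S, ε, hε, h⟩ := hU3 ω hω.1
      obtain ⟨T, δ, hδ, h'⟩ := hW3 ω hω.2
      exact ⟨S ∪ T, min ε δ, lt_min hε hδ, Set.subset_inter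
        ((endNhd_mono Finset.subset_union_left (min_le_left _ _) ω).trans h)
        ((endNhd_mono Finset.subset_union_right (min_le_right _ _) ω).trans h')⟩
  isOpen_sUnion := by
    intro s hs
    refine ⟨fun v hv => ?_, fun e t ht => ?_, fun ω hω => ?_⟩
    · obtain ⟨U, hU, hv⟩ := hv
      obtain ⟨ε, hε, h⟩ := (hs U hU).1 v hv
      exact ⟨ε, hε, h.trans (Set.subset_sUnion_of_mem hU)⟩
    · obtain ⟨U, hU, ht⟩ := ht
      obtain ⟨ε, hε, h⟩ := (hs U hU).2.1 e t ht
      exact ⟨ε, hε, h.trans (Set.subset_sUnion_of_mem hU)⟩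
    · obtain ⟨U, hU, hω⟩ := hω
      obtain ⟨S, ε, hε, h⟩ := (hs U hU).2.2 ω hω
      exact ⟨S, ε, hε, h.trans (Set.subset_sUnion_of_mem hU)⟩

/-- The interior of an edge, as a subset of `|G|`. -/
def edgeInterior {G : SimpleGraph V} (e : G.edgeSet) : Set (Point G) :=
  Set.range (Point.inner e)

/-- An edge including its endpoints, as a subset of `|G|`. -/
def closedEdge {G : SimpleGraph V} (e : G.edgeSet) : Set (Point G) :=
  edgeInterior e ∪ Point.vertex '' {v | v ∈ e.1}

/-- A standard subspace of `|G|`: a closed subspace that contains every edge of which it contains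
an inner point. -/
def IsStandardSubspace {G : SimpleGraph V} (X : Set (Point G)) : Prop :=
  IsClosed X ∧ ∀ e : G.edgeSet, (X ∩ edgeInterior e).Nonempty → closedEdge e ⊆ X

/-- `X - S`: delete from `X` the vertices in `S` together with the interiors of all edges that
are incident with a vertex in `S`. -/
def deleteVertices {G : SimpleGraph V} (X : Set (Point G)) (S : Finset V) : Set (Point G) :=
  X \ (Point.vertex '' (S : Set V) ∪ ⋃ e : {e : G.edgeSet // ∃ v ∈ S, v ∈ e.1}, edgeInterior e.1)

/-- `X` is a weakly `k`-connected standard subspace of `|G|`: it contains at least `k + 1`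
vertices, and `X - S` is path-connected for every set `S` of fewer than `k` vertices. -/
def IsWeaklyConnected {G : SimpleGraph V} (k : ℕ) (X : Set (Point G)) : Prop :=
  IsStandardSubspace X ∧
    ((k + 1 : ℕ) : ℕ∞) ≤ {v : V | Point.vertex v ∈ X}.encard ∧
    ∀ S : Finset V, S.card < k → IsPathConnected (deleteVertices X S)

/-- The degree of the vertex `v` in `X`: the number of edges of `G` that are incident with `v`
and contained in `X`. -/
noncomputable def degreeIn {G : SimpleGraph V} (X : Set (Point G)) (v : V) : ℕ∞ :=
  {e : G.edgeSet | v ∈ e.1 ∧ closedEdge e ⊆ X}.encard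

end GraphSpace

namespace GraphSpace

variable {V : Type*}

/-! This is Mader's cycle argument, carried over to a space whose paths may run through ends.
Suppose no vertex of `C` has degree `k`. Each edge `xy` of `C` is critical, so some set of fewer
than `k` vertices splits `X` minus that edge into a side of `x` and a side of `y`
(`exists_edgeSeparation`). For consecutive edges `yx` and `xz` the two separations are uncrossed. If
the corner at `x` had a boundary of at most `k - 2` vertices, it would be `{x}` and `x` would have
degree `k` (`EdgeSeparation.eq_of_card_sep_lt`). Otherwise the opposite corner has a boundary of
fewer than `k` vertices and contains no vertex (`EdgeSeparation.disjoint_right`). Counting then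
makes the side of `z` smaller than the side of `x` in the first separation
(`EdgeSeparation.encard_diff_lt`), which cannot go on around a cycle (`false_of_encard_diff_lt`).

Topology enters once. The corners are closed under adjacency, but a path could still leave them
through an end. `FinitelyInvariant.mem_edgeExtension_of_joinedIn` excludes this: the corners are
unions of path components off a finite vertex set `F`, and near an end a path can be pushed off `F`.
-/

/-! ### Open sets of `|G|`, and edges as arcs. -/

theorem isOpen_iff {G : SimpleGraph V} {U : Set (Point G)} : IsOpen U ↔
    (∀ v, Point.vertex v ∈ U → ∃ ε > 0, vertexNhd G ε v ⊆ U) ∧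
    (∀ e t, Point.inner e t ∈ U → ∃ ε > 0, innerNhd ε e t ⊆ U) ∧
    (∀ ω, Point.ofEnd ω ∈ U → ∃ S : Finset V, ∃ ε > 0, endNhd S ε ω ⊆ U) :=
  Iff.rfl

theorem isOpen_edgeInterior {G : SimpleGraph V} (e : G.edgeSet) : IsOpen (edgeInterior e) := by
  refine isOpen_iff.2 ⟨?_, ?_, ?_⟩
  · rintro v ⟨t, ht⟩
    cases ht
  · rintro e' t ⟨t', ht⟩
    cases ht
    refine ⟨1, one_pos, ?_⟩
    rintro p ⟨s, rfl, -⟩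
    exact ⟨s, rfl⟩
  · rintro ω ⟨t, ht⟩
    cases ht

/-- The open star of a vertex. -/
def openStar (G : SimpleGraph V) (v : V) : Set (Point G) :=
  {p | p = Point.vertex v ∨ ∃ e t, p = Point.inner e t ∧ v ∈ e.1}

theorem isOpen_openStar (G : SimpleGraph V) (v : V) : IsOpen (openStar G v) := by
  refine isOpen_iff.2 ⟨?_, ?_, ?_⟩
  · rintro w (h | ⟨e, t, h, -⟩)
    · cases h
      refine ⟨1, one_pos, ?_⟩
      rintro p (rfl | ⟨e, t, rfl, hv, -⟩)
      · exact Or.inl rfl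
      · exact Or.inr ⟨e, t, rfl, hv⟩
    · cases h
  · rintro e t (h | ⟨e', t', h, hv⟩)
    · cases h
    · cases h
      refine ⟨1, one_pos, ?_⟩
      rintro p ⟨s, rfl, -⟩
      exact Or.inr ⟨e, s, rfl, hv⟩
  · rintro ω (h | ⟨e, t, h, -⟩) <;> cases h

theorem isStandardSubspace_diff_edgeInterior {G : SimpleGraph V} {X : Set (Point G)}
    (hX : IsStandardSubspace X) (e : G.edgeSet) : IsStandardSubspace (X \ edgeInterior e) := by
  refine ⟨hX.1.sdiff (isOpen_edgeInterior e), ?_⟩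
  rintro f ⟨p, ⟨hpX, hpe⟩, hpf⟩
  refine fun q hq => ⟨hX.2 f ⟨p, hpX, hpf⟩ hq, ?_⟩
  rintro ⟨t, rfl⟩
  obtain ⟨s, rfl⟩ := hpf
  rcases hq with ⟨t', h⟩ | ⟨v, -, h⟩
  · cases h
    exact hpe ⟨s, rfl⟩
  · cases h

theorem mk_out {G : SimpleGraph V} (e : G.edgeSet) :
    s((Quot.out e.1).1, (Quot.out e.1).2) = e.1 :=
  Quot.out_eq e.1

theorem out_fst_mem {G : SimpleGraph V} (e : G.edgeSet) : (Quot.out e.1).1 ∈ e.1 :=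
  Sym2.out_fst_mem e.1

theorem out_snd_mem {G : SimpleGraph V} (e : G.edgeSet) : (Quot.out e.1).2 ∈ e.1 :=
  Sym2.out_snd_mem e.1

theorem out_fst_ne_snd {G : SimpleGraph V} (e : G.edgeSet) :
    (Quot.out e.1).1 ≠ (Quot.out e.1).2 := by
  have h : s((Quot.out e.1).1, (Quot.out e.1).2) ∈ G.edgeSet := by
    rw [mk_out e]
    exact e.2
  exact G.ne_of_adj h

open Classical in
/-- A parametrization of a closed edge by the real line, constant outside the unit interval. -/
noncomputable def edgeMap {G : SimpleGraph V} (e : G.edgeSet) (t : ℝ) : Point G :=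
  if h : t ∈ Set.Ioo (0 : ℝ) 1 then Point.inner e ⟨t, h⟩
  else if t ≤ 0 then Point.vertex (Quot.out e.1).1 else Point.vertex (Quot.out e.1).2

theorem continuous_edgeMap {G : SimpleGraph V} (e : G.edgeSet) : Continuous (edgeMap e) := by
  refine continuous_def.2 fun O hO => Metric.isOpen_iff.2 fun t ht => ?_
  obtain ⟨hv, hi, -⟩ := isOpen_iff.1 hO
  rw [Set.mem_preimage] at ht
  rcases le_or_gt t 0 with h0 | h0
  · have hft : edgeMap e t = Point.vertex (Quot.out e.1).1 := by
      rw [edgeMap, dif_neg (fun h => absurd h.1 (not_lt.2 h0)), if_pos h0]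
    rw [hft] at ht
    obtain ⟨ε, hε, hsub⟩ := hv _ ht
    refine ⟨min ε 1, lt_min hε one_pos, fun s hs => ?_⟩
    rw [Metric.mem_ball, Real.dist_eq, abs_lt, lt_min_iff] at hs
    refine hsub ?_
    rcases le_or_gt s 0 with h | h
    · rw [edgeMap, dif_neg (fun h' => absurd h'.1 (not_lt.2 h)), if_pos h]
      exact Or.inl rfl
    · have hs1 : s ∈ Set.Ioo (0 : ℝ) 1 := ⟨h, by linarith [hs.2.2]⟩
      rw [edgeMap, dif_pos hs1]
      refine Or.inr ⟨e, ⟨s, hs1⟩, rfl, out_fst_mem e, ?_⟩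
      rw [distTo, if_pos rfl]
      linarith [hs.2.1]
  rcases lt_or_ge t 1 with h1 | h1
  · have hft : edgeMap e t = Point.inner e ⟨t, h0, h1⟩ := by
      rw [edgeMap, dif_pos ⟨h0, h1⟩]
    rw [hft] at ht
    obtain ⟨ε, hε, hsub⟩ := hi _ _ ht
    refine ⟨min ε (min t (1 - t)), lt_min hε (lt_min h0 (by linarith)), fun s hs => ?_⟩
    rw [Metric.mem_ball, Real.dist_eq, lt_min_iff, lt_min_iff] at hs
    obtain ⟨hs1, hs2, hs3⟩ := hs
    rw [abs_lt] at hs2 hs3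
    have hs : s ∈ Set.Ioo (0 : ℝ) 1 := ⟨by linarith, by linarith⟩
    rw [Set.mem_preimage, edgeMap, dif_pos hs]
    exact hsub ⟨_, rfl, hs1⟩
  · have hft : edgeMap e t = Point.vertex (Quot.out e.1).2 := by
      rw [edgeMap, dif_neg (fun h => absurd h.2 (not_lt.2 h1)), if_neg (not_le.2 h0)]
    rw [hft] at ht
    obtain ⟨ε, hε, hsub⟩ := hv _ ht
    refine ⟨min ε 1, lt_min hε one_pos, fun s hs => ?_⟩
    rw [Metric.mem_ball, Real.dist_eq, abs_lt, lt_min_iff] at hs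
    have hle := min_le_left ε 1
    have hle' := min_le_right ε 1
    have hs0 : 0 < s := by linarith [hs.1]
    refine hsub ?_
    rcases lt_or_ge s 1 with h | h
    · rw [edgeMap, dif_pos ⟨hs0, h⟩]
      refine Or.inr ⟨e, ⟨s, hs0, h⟩, rfl, out_snd_mem e, ?_⟩
      rw [distTo, if_neg (out_fst_ne_snd e).symm]
      change 1 - s < ε
      linarith [hs.1]
    · rw [edgeMap, dif_neg (fun h' => absurd h'.2 (not_lt.2 h)), if_neg (not_le.2 hs0)]
      exact Or.inl rfl

theorem range_edgeMap {G : SimpleGraph V} (e : G.edgeSet) :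
    Set.range (edgeMap e) = closedEdge e := by
  refine Set.Subset.antisymm ?_ ?_
  · rintro _ ⟨t, rfl⟩
    rw [edgeMap]
    split_ifs with h h'
    · exact Or.inl ⟨_, rfl⟩
    · exact Or.inr ⟨_, out_fst_mem e, rfl⟩
    · exact Or.inr ⟨_, out_snd_mem e, rfl⟩
  · rintro p (⟨t, rfl⟩ | ⟨v, hv, rfl⟩)
    · exact ⟨t.1, by rw [edgeMap, dif_pos t.2]⟩
    · rw [Set.mem_ofPred_eq, ← mk_out e, Sym2.mem_iff] at hv
      rcases hv with rfl | rfl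
      · exact ⟨0, by rw [edgeMap, dif_neg (by simp), if_pos le_rfl]⟩
      · exact ⟨1, by rw [edgeMap, dif_neg (by simp), if_neg (by norm_num)]⟩

theorem isPathConnected_closedEdge {G : SimpleGraph V} (e : G.edgeSet) :
    IsPathConnected (closedEdge e) := by
  rw [← range_edgeMap]
  exact isPathConnected_range (continuous_edgeMap e)

/-! ### Deleting vertices from a subspace. -/

theorem mem_deleteVertices {G : SimpleGraph V} {X : Set (Point G)} {S : Finset V} {p : Point G} :
    p ∈ deleteVertices X S ↔ p ∈ X ∧ (∀ v ∈ S, p ≠ Point.vertex v) ∧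
      ∀ e t, p = Point.inner e t → ∀ v ∈ e.1, v ∉ S := by
  constructor
  · rintro ⟨hX, h⟩
    refine ⟨hX, fun v hv hp => h (Or.inl ⟨v, hv, hp.symm⟩), fun e t hp v hv hvS => ?_⟩
    exact h (Or.inr (Set.mem_iUnion.2 ⟨⟨e, v, hvS, hv⟩, t, hp.symm⟩))
  · rintro ⟨hX, h1, h2⟩
    refine ⟨hX, ?_⟩
    rintro (⟨v, hv, rfl⟩ | h)
    · exact h1 v hv rfl
    · obtain ⟨⟨e, v, hvS, hv⟩, t, rfl⟩ := Set.mem_iUnion.1 h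
      exact h2 e t rfl v hv hvS

theorem vertex_mem_deleteVertices {G : SimpleGraph V} {X : Set (Point G)} {S : Finset V} {v : V} :
    Point.vertex v ∈ deleteVertices X S ↔ Point.vertex v ∈ X ∧ v ∉ S := by
  rw [mem_deleteVertices]
  constructor
  · rintro ⟨h, h', -⟩
    exact ⟨h, fun hv => h' v hv rfl⟩
  · rintro ⟨h, h'⟩
    refine ⟨h, ?_, ?_⟩
    · rintro w hw hvw
      cases hvw
      exact h' hw
    · rintro e t ht
      cases ht

theorem inner_mem_deleteVertices {G : SimpleGraph V} {X : Set (Point G)} {S : Finset V}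
    {e : G.edgeSet} {t : Set.Ioo (0 : ℝ) 1} :
    Point.inner e t ∈ deleteVertices X S ↔ Point.inner e t ∈ X ∧ ∀ v ∈ e.1, v ∉ S := by
  rw [mem_deleteVertices]
  constructor
  · rintro ⟨h, -, h'⟩
    exact ⟨h, h' e t rfl⟩
  · rintro ⟨h, h'⟩
    refine ⟨h, ?_, ?_⟩
    · rintro w hw hvw
      cases hvw
    · rintro e t ht
      cases ht
      exact h'

theorem ofEnd_mem_deleteVertices {G : SimpleGraph V} {X : Set (Point G)} {S : Finset V}
    {ω : End G} : Point.ofEnd ω ∈ deleteVertices X S ↔ Point.ofEnd ω ∈ X := by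
  rw [mem_deleteVertices]
  refine ⟨fun h => h.1, fun h => ⟨h, ?_, ?_⟩⟩
  · rintro w hw hvw
    cases hvw
  · rintro e t ht
    cases ht

theorem deleteVertices_anti {G : SimpleGraph V} (X : Set (Point G)) {S T : Finset V}
    (h : S ⊆ T) : deleteVertices X T ⊆ deleteVertices X S := by
  intro p hp
  rw [mem_deleteVertices] at hp ⊢
  exact ⟨hp.1, fun v hv => hp.2.1 v (h hv), fun e t he v hv hS => hp.2.2 e t he v hv (h hS)⟩

theorem closedEdge_subset_deleteVertices {G : SimpleGraph V} {X : Set (Point G)} {S : Finset V}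
    {e : G.edgeSet} (he : closedEdge e ⊆ X) (hS : ∀ v ∈ e.1, v ∉ S) :
    closedEdge e ⊆ deleteVertices X S := by
  intro p hp
  have hpX := he hp
  rcases hp with ⟨t, rfl⟩ | ⟨v, hv, rfl⟩
  · exact inner_mem_deleteVertices.2 ⟨hpX, hS⟩
  · exact vertex_mem_deleteVertices.2 ⟨hpX, hS v hv⟩

theorem mem_closedEdge_inner {G : SimpleGraph V} (e : G.edgeSet) (t : Set.Ioo (0 : ℝ) 1) :
    Point.inner e t ∈ closedEdge e :=
  Or.inl ⟨t, rfl⟩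

theorem mem_closedEdge_vertex {G : SimpleGraph V} {e : G.edgeSet} {v : V} (hv : v ∈ e.1) :
    (Point.vertex v : Point G) ∈ closedEdge e :=
  Or.inr ⟨v, hv, rfl⟩

/-! ### Pushing paths off a finite vertex set. -/

open Classical in
/-- The retraction that collapses each edge with exactly one endpoint in `F` to its endpoint
outside `F`. -/
noncomputable def collapse {G : SimpleGraph V} (F : Finset V) : Point G → Point G
  | Point.vertex v => Point.vertex v
  | Point.ofEnd ω => Point.ofEnd ω
  | Point.inner e t =>
      if h : ∃ v, v ∉ F ∧ ∃ s ∈ F, e.1 = s(s, v) then Point.vertex h.choose else Point.inner e t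

theorem collapse_inner_of_eq {G : SimpleGraph V} {F : Finset V} {e : G.edgeSet} {s v : V}
    (hs : s ∈ F) (hv : v ∉ F) (he : e.1 = s(s, v)) (t : Set.Ioo (0 : ℝ) 1) :
    collapse F (Point.inner e t) = Point.vertex v := by
  have h : ∃ v, v ∉ F ∧ ∃ s ∈ F, e.1 = s(s, v) := ⟨v, hv, s, hs, he⟩
  have hc : h.choose = v := by
    have hspec := h.choose_spec
    generalize h.choose = w at hspec
    obtain ⟨h1, s', -, h2⟩ := hspec
    have hmem : w ∈ e.1 := h2 ▸ Sym2.mem_mk_right s' w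
    rw [he, Sym2.mem_iff] at hmem
    rcases hmem with rfl | rfl
    · exact absurd hs h1
    · rfl
  rw [collapse, dif_pos h, hc]

theorem collapse_inner_of_forall_notMem {G : SimpleGraph V} {F : Finset V} {e : G.edgeSet}
    (h : ∀ v ∈ e.1, v ∉ F) (t : Set.Ioo (0 : ℝ) 1) :
    collapse F (Point.inner e t) = Point.inner e t := by
  rw [collapse, dif_neg]
  rintro ⟨v, -, s, hs, he⟩
  exact h s (by rw [he]; exact Sym2.mem_mk_left _ _) hs

theorem exists_eq_mk_or_forall_notMem {G : SimpleGraph V} (F : Finset V) (e : G.edgeSet)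
    {v : V} (hv : v ∈ e.1) (hvF : v ∉ F) :
    (∃ s ∈ F, e.1 = s(s, v)) ∨ ∀ w ∈ e.1, w ∉ F := by
  obtain ⟨w, hw⟩ := hv
  by_cases h : w ∈ F
  · exact Or.inl ⟨w, h, by rw [hw, Sym2.eq_swap]⟩
  · refine Or.inr fun x hx => ?_
    rw [hw, Sym2.mem_iff] at hx
    rcases hx with rfl | rfl <;> assumption

/-- The points that are neither vertices in `F` nor inner points of edges with both endpoints
in `F`. -/
def awayFrom (G : SimpleGraph V) (F : Finset V) : Set (Point G) :=
  {p | match p with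
    | Point.vertex v => v ∉ F
    | Point.inner e _ => ∃ v ∈ e.1, v ∉ F
    | Point.ofEnd _ => True}

theorem isOpen_awayFrom (G : SimpleGraph V) (F : Finset V) : IsOpen (awayFrom G F) := by
  refine isOpen_iff.2 ⟨fun v hv => ⟨1, one_pos, ?_⟩, fun e t h => ⟨1, one_pos, ?_⟩,
    fun ω _ => ⟨F, 1, one_pos, ?_⟩⟩
  · rintro p (rfl | ⟨e, t, rfl, hve, -⟩)
    · exact hv
    · exact ⟨v, hve, hv⟩
  · rintro p ⟨s, rfl, -⟩
    exact h
  · rintro (v | ⟨e, t⟩ | ω') hp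
    · exact notMem_of_mem_endComp hp
    · rcases hp with hp | ⟨s, -, v, hv, he, -⟩
      · exact ⟨_, out_fst_mem e, notMem_of_mem_endComp (hp _ (out_fst_mem e))⟩
      · exact ⟨v, by rw [he]; exact Sym2.mem_mk_right _ _, notMem_of_mem_endComp hv⟩
    · trivial

/-- The delicate points are the ends: once `F` is added to the finite set defining a neighbourhood,
every collapsed edge meeting it has its endpoint outside `F` in the component, so its image stays in
the neighbourhood. -/
theorem continuousOn_collapse {G : SimpleGraph V} (F : Finset V) :
    ContinuousOn (collapse F) (awayFrom G F) := by
  classical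
  refine (continuousOn_open_iff (isOpen_awayFrom G F)).2 fun O hO => ?_
  obtain ⟨hv, hi, he⟩ := isOpen_iff.1 hO
  obtain ⟨av, ai, ae⟩ := isOpen_iff.1 (isOpen_awayFrom G F)
  refine isOpen_iff.2 ⟨?_, ?_, ?_⟩
  · rintro v ⟨hvF, hvO⟩
    obtain ⟨ε, hε, hsub⟩ := hv v hvO
    refine ⟨ε, hε, ?_⟩
    rintro p (rfl | ⟨e, t, rfl, hve, hd⟩)
    · exact ⟨hvF, hvO⟩
    · refine ⟨⟨v, hve, hvF⟩, ?_⟩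
      rw [Set.mem_preimage]
      rcases exists_eq_mk_or_forall_notMem F e hve hvF with ⟨s, hs, hes⟩ | h
      · rw [collapse_inner_of_eq hs hvF hes]
        exact hvO
      · rw [collapse_inner_of_forall_notMem h]
        exact hsub (Or.inr ⟨e, t, rfl, hve, hd⟩)
  · rintro e t ⟨⟨v, hve, hvF⟩, hO⟩
    rw [Set.mem_preimage] at hO
    rcases exists_eq_mk_or_forall_notMem F e hve hvF with ⟨s, hs, hes⟩ | h
    · refine ⟨1, one_pos, ?_⟩
      rintro p ⟨t', rfl, -⟩
      refine ⟨⟨v, hve, hvF⟩, ?_⟩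
      rw [collapse_inner_of_eq hs hvF hes] at hO
      rwa [Set.mem_preimage, collapse_inner_of_eq hs hvF hes]
    · rw [collapse_inner_of_forall_notMem h] at hO
      obtain ⟨ε, hε, hsub⟩ := hi e t hO
      refine ⟨ε, hε, ?_⟩
      rintro p ⟨t', rfl, hd⟩
      refine ⟨⟨v, hve, hvF⟩, ?_⟩
      rw [Set.mem_preimage, collapse_inner_of_forall_notMem h]
      exact hsub ⟨t', rfl, hd⟩
  · rintro ω ⟨-, hO⟩
    obtain ⟨S, ε, hε, hsub⟩ := he ω hO
    refine ⟨F ∪ S, ε, hε, ?_⟩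
    have hmono := (endNhd_mono (Finset.subset_union_right (s₁ := F) (s₂ := S)) le_rfl ω).trans hsub
    have hcomp {v : V} (hv : v ∈ endComp (F ∪ S) ω) : v ∉ F := fun h =>
      notMem_of_mem_endComp hv (Finset.mem_union_left _ h)
    rintro (v | ⟨e, t⟩ | ω') hp
    · exact ⟨hcomp hp, hmono hp⟩
    · have hpO := hmono hp
      have key : ∃ v ∈ endComp (F ∪ S) ω, v ∈ e.1 := by
        rcases hp with hp | ⟨s, -, v, hv, he, -⟩
        · exact ⟨_, hp _ (out_fst_mem e), out_fst_mem e⟩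
        · exact ⟨v, hv, by rw [he]; exact Sym2.mem_mk_right _ _⟩
      obtain ⟨v, hvC, hve⟩ := key
      refine ⟨⟨v, hve, hcomp hvC⟩, ?_⟩
      rw [Set.mem_preimage]
      rcases exists_eq_mk_or_forall_notMem F e hve (hcomp hvC) with ⟨s, hs, hes⟩ | h
      · rw [collapse_inner_of_eq hs (hcomp hvC) hes]
        exact hmono (show Point.vertex v ∈ endNhd (F ∪ S) ε ω from hvC)
      · rwa [collapse_inner_of_forall_notMem h]
    · exact ⟨trivial, hmono hp⟩

theorem collapse_mem_deleteVertices {G : SimpleGraph V} {X : Set (Point G)}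
    (hX : IsStandardSubspace X) {F : Finset V} {p : Point G} (hp : p ∈ X)
    (hpF : p ∈ awayFrom G F) : collapse F p ∈ deleteVertices X F := by
  rcases p with v | ⟨e, t⟩ | ω
  · exact vertex_mem_deleteVertices.2 ⟨hp, hpF⟩
  · obtain ⟨v, hve, hvF⟩ := hpF
    have heX := hX.2 e ⟨_, hp, t, rfl⟩
    rcases exists_eq_mk_or_forall_notMem F e hve hvF with ⟨s, hs, hes⟩ | h
    · rw [collapse_inner_of_eq hs hvF hes]
      exact vertex_mem_deleteVertices.2 ⟨heX (mem_closedEdge_vertex hve), hvF⟩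
    · rw [collapse_inner_of_forall_notMem h]
      exact inner_mem_deleteVertices.2 ⟨hp, h⟩
  · exact ofEnd_mem_deleteVertices.2 hp

/-! ### Sets that paths cannot leave except along edges. -/

/-- `a` and `b` are the endpoints of an edge contained in `X`. -/
def AdjIn {G : SimpleGraph V} (X : Set (Point G)) (a b : V) : Prop :=
  ∃ e : G.edgeSet, e.1 = s(a, b) ∧ closedEdge e ⊆ X

theorem AdjIn.symm {G : SimpleGraph V} {X : Set (Point G)} {a b : V} (h : AdjIn X a b) :
    AdjIn X b a := by
  obtain ⟨e, he, heX⟩ := h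
  exact ⟨e, by rw [he, Sym2.eq_swap], heX⟩

theorem AdjIn.left_mem {G : SimpleGraph V} {X : Set (Point G)} {a b : V} (h : AdjIn X a b) :
    Point.vertex a ∈ X := by
  obtain ⟨e, he, heX⟩ := h
  exact heX (mem_closedEdge_vertex (by rw [he]; exact Sym2.mem_mk_left _ _))

theorem AdjIn.ne {G : SimpleGraph V} {X : Set (Point G)} {a b : V} (h : AdjIn X a b) :
    a ≠ b := by
  obtain ⟨e, he, -⟩ := h
  have := e.2
  rw [he] at this
  exact G.ne_of_adj this

/-- Off some finite set of vertices, `W` is a union of path components of `X`. -/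
def FinitelyInvariant {G : SimpleGraph V} (X W : Set (Point G)) : Prop :=
  ∃ F : Finset V, ∀ p q, JoinedIn (deleteVertices X F) p q → (p ∈ W ↔ q ∈ W)

theorem FinitelyInvariant.inter {G : SimpleGraph V} {X W W' : Set (Point G)}
    (h : FinitelyInvariant X W) (h' : FinitelyInvariant X W') :
    FinitelyInvariant X (W ∩ W') := by
  classical
  obtain ⟨F, hF⟩ := h
  obtain ⟨F', hF'⟩ := h'
  refine ⟨F ∪ F', fun p q hpq => ?_⟩
  exact and_congr (hF p q (hpq.mono (deleteVertices_anti X Finset.subset_union_left)))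
    (hF' p q (hpq.mono (deleteVertices_anti X Finset.subset_union_right)))

theorem FinitelyInvariant.union {G : SimpleGraph V} {X W W' : Set (Point G)}
    (h : FinitelyInvariant X W) (h' : FinitelyInvariant X W') :
    FinitelyInvariant X (W ∪ W') := by
  classical
  obtain ⟨F, hF⟩ := h
  obtain ⟨F', hF'⟩ := h'
  refine ⟨F ∪ F', fun p q hpq => ?_⟩
  exact or_congr (hF p q (hpq.mono (deleteVertices_anti X Finset.subset_union_left)))
    (hF' p q (hpq.mono (deleteVertices_anti X Finset.subset_union_right)))

theorem finitelyInvariant_singleton {G : SimpleGraph V} (X : Set (Point G)) (v : V) :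
    FinitelyInvariant X {Point.vertex v} := by
  refine ⟨{v}, fun p q hpq => ?_⟩
  have key : ∀ p ∈ deleteVertices X {v}, p ∉ ({Point.vertex v} : Set (Point G)) := by
    rintro p hp rfl
    exact (vertex_mem_deleteVertices.1 hp).2 (Finset.mem_singleton_self v)
  exact iff_of_false (key p hpq.source_mem) (key q hpq.target_mem)

/-- The set of points that agrees with `W` on the vertices and ends and that contains the inner
points of the edges with both endpoints in `W`. -/
def edgeExtension {G : SimpleGraph V} (W : Set (Point G)) : Set (Point G) :=
  {p | match p with
    | Point.vertex v => Point.vertex v ∈ W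
    | Point.inner e _ => ∀ v ∈ e.1, Point.vertex v ∈ W
    | Point.ofEnd ω => Point.ofEnd ω ∈ W}

/-- By closure under adjacency, the two endpoints of an edge of `X - U` are both in `W` or both
outside, so either one decides. -/
theorem inner_mem_edgeExtension {G : SimpleGraph V} {X W : Set (Point G)} {U : Finset V}
    (hX : IsStandardSubspace X)
    (hE : ∀ a b, AdjIn X a b → a ∉ U → b ∉ U → Point.vertex a ∈ W → Point.vertex b ∈ W)
    {e : G.edgeSet} {t : Set.Ioo (0 : ℝ) 1} (h : Point.inner e t ∈ deleteVertices X U)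
    {v : V} (hv : v ∈ e.1) : Point.inner e t ∈ edgeExtension W ↔ Point.vertex v ∈ W := by
  obtain ⟨hpX, hU⟩ := inner_mem_deleteVertices.1 h
  refine ⟨fun h => h v hv, fun hvW w hw => ?_⟩
  obtain ⟨v', hv'⟩ := id hv
  rw [hv', Sym2.mem_iff] at hw
  rcases hw with rfl | rfl
  · exact hvW
  · exact hE v w ⟨e, hv', hX.2 e ⟨_, hpX, t, rfl⟩⟩ (hU v hv)
      (hU w (hv' ▸ Sym2.mem_mk_right v w)) hvW

theorem collapse_mem_edgeExtension {G : SimpleGraph V} {X W : Set (Point G)} {U F : Finset V}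
    (hX : IsStandardSubspace X)
    (hE : ∀ a b, AdjIn X a b → a ∉ U → b ∉ U → Point.vertex a ∈ W → Point.vertex b ∈ W)
    {p : Point G} (h : p ∈ deleteVertices X U) (hF : p ∈ awayFrom G F) :
    collapse F p ∈ edgeExtension W ↔ p ∈ edgeExtension W := by
  rcases p with v | ⟨e, t⟩ | ω
  · exact Iff.rfl
  · obtain ⟨v, hve, hvF⟩ := hF
    rcases exists_eq_mk_or_forall_notMem F e hve hvF with ⟨s, hs, hes⟩ | h'
    · rw [collapse_inner_of_eq hs hvF hes]
      exact (inner_mem_edgeExtension hX hE h hve).symm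
    · rw [collapse_inner_of_forall_notMem h']
  · exact Iff.rfl

theorem joinedIn_vertex_inner {G : SimpleGraph V} {X : Set (Point G)} {S : Finset V}
    (hX : IsStandardSubspace X) {e : G.edgeSet} {t : Set.Ioo (0 : ℝ) 1}
    (h : Point.inner e t ∈ deleteVertices X S) {v : V} (hv : v ∈ e.1) :
    JoinedIn (deleteVertices X S) (Point.vertex v) (Point.inner e t) := by
  obtain ⟨hpX, hS⟩ := inner_mem_deleteVertices.1 h
  exact ((isPathConnected_closedEdge e).joinedIn _ (mem_closedEdge_vertex hv) _
    (mem_closedEdge_inner e t)).mono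
    (closedEdge_subset_deleteVertices (hX.2 e ⟨_, hpX, t, rfl⟩) hS)

theorem joinedIn_of_adjIn {G : SimpleGraph V} {X : Set (Point G)} {S : Finset V} {a b : V}
    (h : AdjIn X a b) (ha : a ∉ S) (hb : b ∉ S) :
    JoinedIn (deleteVertices X S) (Point.vertex a) (Point.vertex b) := by
  obtain ⟨e, he, heX⟩ := h
  refine ((isPathConnected_closedEdge e).joinedIn _ (mem_closedEdge_vertex ?_) _
    (mem_closedEdge_vertex ?_)).mono (closedEdge_subset_deleteVertices heX ?_)
  · rw [he]; exact Sym2.mem_mk_left _ _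
  · rw [he]; exact Sym2.mem_mk_right _ _
  · intro v hv
    rw [he, Sym2.mem_iff] at hv
    rcases hv with rfl | rfl <;> assumption

/-- `edgeExtension` ignores which inner points lie in `W`, so an inner point is first moved to an
endpoint of its edge, which is still in `X - F`. -/
theorem mem_edgeExtension_iff_of_joinedIn_ofEnd {G : SimpleGraph V} {X W : Set (Point G)} {U F : Finset V}
    (hX : IsStandardSubspace X)
    (hF : ∀ p q, JoinedIn (deleteVertices X F) p q → (p ∈ W ↔ q ∈ W))
    (hE : ∀ a b, AdjIn X a b → a ∉ U → b ∉ U → Point.vertex a ∈ W → Point.vertex b ∈ W)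
    {p : Point G} {ω : End G} (hpU : p ∈ deleteVertices X U)
    (h : JoinedIn (deleteVertices X F) p (Point.ofEnd ω)) :
    p ∈ edgeExtension W ↔ Point.ofEnd ω ∈ W := by
  rcases p with v | ⟨e, t⟩ | ω'
  · exact hF _ _ h
  · rw [inner_mem_edgeExtension hX hE hpU (out_fst_mem e)]
    exact hF _ _ ((joinedIn_vertex_inner hX h.source_mem (out_fst_mem e)).trans h)
  · exact hF _ _ h

theorem collapse_mem_deleteVertices_of_mem {G : SimpleGraph V} {X : Set (Point G)}
    (hX : IsStandardSubspace X) {F U : Finset V} {p : Point G} (hp : p ∈ deleteVertices X U)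
    (hpF : p ∈ awayFrom G F) : collapse F p ∈ deleteVertices X U := by
  rcases p with v | ⟨e, t⟩ | ω
  · exact hp
  · obtain ⟨v, hve, hvF⟩ := hpF
    rcases exists_eq_mk_or_forall_notMem F e hve hvF with ⟨s, hs, hes⟩ | h
    · rw [collapse_inner_of_eq hs hvF hes]
      exact (joinedIn_vertex_inner hX hp hve).source_mem
    · rwa [collapse_inner_of_forall_notMem h]
  · exact hp

/-- A finitely invariant set that is closed under the adjacency of `X - U` is closed under
path-connectedness in `X - U`. -/
theorem FinitelyInvariant.mem_edgeExtension_of_joinedIn {G : SimpleGraph V} {X W : Set (Point G)}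
    {U : Finset V} (hX : IsStandardSubspace X) (hW : FinitelyInvariant X W)
    (hE : ∀ a b, AdjIn X a b → a ∉ U → b ∉ U → Point.vertex a ∈ W → Point.vertex b ∈ W)
    {p q : Point G} (h : JoinedIn (deleteVertices X U) p q) (hp : p ∈ edgeExtension W) :
    q ∈ edgeExtension W := by
  obtain ⟨F, hF⟩ := hW
  obtain ⟨γ, hγ⟩ := h
  -- Extending the path to the whole line makes small neighbourhoods of a parameter into balls,
  -- which are convex.
  have hg : ∀ t, γ.extend t ∈ deleteVertices X U := fun t => by
    obtain ⟨s, hs⟩ : γ.extend t ∈ Set.range γ := γ.extend_range ▸ Set.mem_range_self t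
    exact hs ▸ hγ s
  have hgc : Continuous γ.extend := γ.continuous_extend
  have hg0 := γ.extend_zero
  have hg1 := γ.extend_one
  generalize γ.extend = g at hg hgc hg0 hg1
  -- Near a vertex the path stays in its open star, and near an inner point in its edge. Near an end
  -- it stays in `awayFrom G F`, where `collapse F` turns it into a path of `X - F`, to which the
  -- invariance of `W` applies.
  have hloc : IsLocallyConstant fun t => g t ∈ edgeExtension W := by
    rw [IsLocallyConstant.iff_eventually_eq]
    intro t
    have hnhd {O : Set (Point G)} (hO : IsOpen O) (ht : g t ∈ O) : ∀ᶠ s in nhds t, g s ∈ O :=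
      hgc.continuousAt.eventually (hO.mem_nhds ht)
    rcases hgt : g t with v | ⟨e, r⟩ | ω
    · filter_upwards [hnhd (isOpen_openStar G v) (Or.inl hgt)] with s hs
      rcases hs with hs | ⟨e, r, hs, hve⟩
      · rw [hs]
      · rw [hs]
        exact propext (inner_mem_edgeExtension hX hE (hs ▸ hg s) hve)
    · filter_upwards [hnhd (isOpen_edgeInterior e) ⟨r, hgt.symm⟩] with s ⟨r', hs⟩
      rw [← hs]
      rfl
    · obtain ⟨ε, hε, hball⟩ := Metric.eventually_nhds_iff_ball.1
        (hnhd (isOpen_awayFrom G F) (by rw [hgt]; trivial))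
      have hpc : IsPathConnected ((collapse F ∘ g) '' Metric.ball t ε) :=
        ((convex_ball t ε).isPathConnected ⟨t, Metric.mem_ball_self hε⟩).image'
          ((continuousOn_collapse F).comp hgc.continuousOn hball)
      have hsub : (collapse F ∘ g) '' Metric.ball t ε ⊆ deleteVertices X F := by
        rintro _ ⟨s, hs, rfl⟩
        exact collapse_mem_deleteVertices hX (mem_deleteVertices.1 (hg s)).1 (hball s hs)
      filter_upwards [Metric.ball_mem_nhds t hε] with s hs
      have hjoin : JoinedIn (deleteVertices X F) (collapse F (g s)) (Point.ofEnd ω) := by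
        have := hpc.joinedIn _ ⟨s, hs, rfl⟩ _ ⟨t, Metric.mem_ball_self hε, rfl⟩
        rw [Function.comp_apply, Function.comp_apply, hgt] at this
        exact this.mono hsub
      have hmem : collapse F (g s) ∈ edgeExtension W ↔ Point.ofEnd ω ∈ W :=
        mem_edgeExtension_iff_of_joinedIn_ofEnd hX hF hE
          (collapse_mem_deleteVertices_of_mem hX (hg s) (hball s hs)) hjoin
      exact propext ((collapse_mem_edgeExtension hX hE (hg s) (hball s hs)).symm.trans hmem)
  have heq := hloc.apply_eq_of_preconnectedSpace 0 1
  simp only [hg0, hg1] at heq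
  exact heq.mp hp

theorem FinitelyInvariant.mem_of_joinedIn {G : SimpleGraph V} {X W : Set (Point G)}
    {U : Finset V} (hX : IsStandardSubspace X) (hW : FinitelyInvariant X W)
    (hE : ∀ a b, AdjIn X a b → a ∉ U → b ∉ U → Point.vertex a ∈ W → Point.vertex b ∈ W)
    {a b : V} (h : JoinedIn (deleteVertices X U) (Point.vertex a) (Point.vertex b))
    (ha : Point.vertex a ∈ W) : Point.vertex b ∈ W :=
  hW.mem_edgeExtension_of_joinedIn hX hE h ha

/-! ### Degrees are at least `k`. -/

theorem degreeIn_eq_encard {G : SimpleGraph V} (X : Set (Point G)) (v : V) :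
    degreeIn X v = {w | AdjIn X v w}.encard := by
  have h : (Subtype.val '' {e : G.edgeSet | v ∈ e.1 ∧ closedEdge e ⊆ X} : Set (Sym2 V)) =
      (fun w => s(v, w)) '' {w | AdjIn X v w} := by
    ext e
    constructor
    · rintro ⟨e, ⟨⟨w, hw⟩, heX⟩, rfl⟩
      exact ⟨w, ⟨e, hw, heX⟩, hw.symm⟩
    · rintro ⟨w, ⟨e, hw, heX⟩, rfl⟩
      exact ⟨e, ⟨by rw [hw]; exact Sym2.mem_mk_left _ _, heX⟩, hw⟩
  rw [degreeIn, ← Subtype.val_injective.encard_image, h,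
    Function.Injective.encard_image fun a b hab => Sym2.congr_right.1 hab]

theorem joinedIn_of_isWeaklyConnected {G : SimpleGraph V} {k : ℕ} {X : Set (Point G)}
    (hX : IsWeaklyConnected k X) {U : Finset V} (hU : U.card < k) {a b : V}
    (ha : Point.vertex a ∈ X) (hb : Point.vertex b ∈ X) (haU : a ∉ U) (hbU : b ∉ U) :
    JoinedIn (deleteVertices X U) (Point.vertex a) (Point.vertex b) :=
  (hX.2.2 U hU).joinedIn _ (vertex_mem_deleteVertices.2 ⟨ha, haU⟩) _
    (vertex_mem_deleteVertices.2 ⟨hb, hbU⟩)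

/-- Fewer than `k` neighbours would separate `v` from a further vertex of `X`. -/
theorem le_degreeIn {G : SimpleGraph V} {k : ℕ} {X : Set (Point G)}
    (hX : IsWeaklyConnected k X) {v : V} (hv : Point.vertex v ∈ X) :
    (k : ℕ∞) ≤ degreeIn X v := by
  classical
  rw [degreeIn_eq_encard]
  by_contra! hlt
  have hfin : {w | AdjIn X v w}.Finite := Set.finite_of_encard_le_coe hlt.le
  set N : Finset V := hfin.toFinset with hN
  have hmem (w : V) : w ∈ N ↔ AdjIn X v w := by simp [hN]
  have hcard : N.card < k := by
    rw [hfin.encard_eq_coe_toFinset_card] at hlt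
    exact_mod_cast hlt
  -- `insert v N` has at most `k` elements, while `X` has at least `k + 1` vertices.
  obtain ⟨z, hz, hzN⟩ : ∃ z, Point.vertex z ∈ X ∧ z ∉ insert v N := by
    by_contra! hall
    have h1 : {w : V | Point.vertex w ∈ X}.encard ≤ ((insert v N : Finset V) : Set V).encard :=
      Set.encard_le_encard hall
    rw [Set.encard_coe_eq_coe_finsetCard] at h1
    have h2 := hX.2.1.trans h1
    have h3 := Finset.card_insert_le v N
    norm_cast at h2
    omega
  rw [Finset.mem_insert, not_or] at hzN
  have hvN : v ∉ N := fun h => ((hmem v).1 h).ne rfl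
  have := (finitelyInvariant_singleton X v).mem_of_joinedIn hX.1 (U := N) (fun a b hab _ hb ha => by
    cases ha
    exact absurd ((hmem b).2 hab) hb)
    (joinedIn_of_isWeaklyConnected hX hcard hv hz hvN hzN.2) rfl
  cases this
  exact hzN.1 rfl

/-! ### Separations obtained from critical edges. -/

/-- A set of fewer than `k` vertices that, together with an edge `xy` of `X`, separates `x`
from `y` in `X`, with the two sides. -/
structure EdgeSeparation {G : SimpleGraph V} (X : Set (Point G)) (k : ℕ) (x y : V) where
  sep : Finset V
  left : Set (Point G)
  right : Set (Point G)
  card_lt : sep.card < k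
  sep_subset : ∀ v ∈ sep, Point.vertex v ∈ X
  left_subset : left ⊆ X
  right_subset : right ⊆ X
  cover : ∀ v, Point.vertex v ∈ X → Point.vertex v ∈ left ∨ Point.vertex v ∈ right ∨ v ∈ sep
  disjoint : ∀ v, Point.vertex v ∈ left → Point.vertex v ∉ right
  left_notMem : ∀ v, Point.vertex v ∈ left → v ∉ sep
  right_notMem : ∀ v, Point.vertex v ∈ right → v ∉ sep
  mem_left : Point.vertex x ∈ left
  mem_right : Point.vertex y ∈ right
  eq_of_adjIn : ∀ a b, AdjIn X a b → Point.vertex a ∈ left → Point.vertex b ∈ right →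
    a = x ∧ b = y
  left_invariant : FinitelyInvariant X left
  right_invariant : FinitelyInvariant X right

/-- The separation with its sides exchanged. -/
def EdgeSeparation.swap {G : SimpleGraph V} {X : Set (Point G)} {k : ℕ} {x y : V}
    (s : EdgeSeparation X k x y) : EdgeSeparation X k y x where
  sep := s.sep
  left := s.right
  right := s.left
  card_lt := s.card_lt
  sep_subset := s.sep_subset
  left_subset := s.right_subset
  right_subset := s.left_subset
  cover v hv := by
    rcases s.cover v hv with h | h | h
    · exact Or.inr (Or.inl h)
    · exact Or.inl h
    · exact Or.inr (Or.inr h)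
  disjoint v h h' := s.disjoint v h' h
  left_notMem := s.right_notMem
  right_notMem := s.left_notMem
  mem_left := s.mem_right
  mem_right := s.mem_left
  eq_of_adjIn a b h ha hb := (s.eq_of_adjIn b a h.symm hb ha).symm
  left_invariant := s.right_invariant
  right_invariant := s.left_invariant

theorem adjIn_diff_edgeInterior {G : SimpleGraph V} {X : Set (Point G)} {e : G.edgeSet} {a b : V}
    (h : AdjIn X a b) (he : e.1 ≠ s(a, b)) : AdjIn (X \ edgeInterior e) a b := by
  obtain ⟨f, hf, hfX⟩ := h
  refine ⟨f, hf, fun p hp => ⟨hfX hp, ?_⟩⟩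
  rintro ⟨t, rfl⟩
  rcases hp with ⟨t', h⟩ | ⟨v, -, h⟩
  · cases h
    exact he hf
  · cases h

/-- Deleting one endpoint of `e` in addition to `S` removes the interior of `e`, so paths of `X`
that avoid these vertices are paths of `X - e - S`. -/
theorem finitelyInvariant_joinedIn {G : SimpleGraph V} (X : Set (Point G)) (S : Finset V)
    (e : G.edgeSet) (q : Point G) :
    FinitelyInvariant X {p | JoinedIn (deleteVertices (X \ edgeInterior e) S) q p} := by
  classical
  refine ⟨insert (Quot.out e.1).1 S, fun p p' hpp' => ?_⟩
  have hsub : deleteVertices X (insert (Quot.out e.1).1 S) ⊆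
      deleteVertices (X \ edgeInterior e) S := by
    intro r hr
    have hr' := mem_deleteVertices.1 hr
    have hrS := mem_deleteVertices.1 (deleteVertices_anti X (Finset.subset_insert _ S) hr)
    refine mem_deleteVertices.2 ⟨⟨hr'.1, ?_⟩, hrS.2⟩
    rintro ⟨t, rfl⟩
    exact hr'.2.2 e t rfl _ (out_fst_mem e) (Finset.mem_insert_self _ _)
  exact ⟨fun h => h.trans (hpp'.mono hsub), fun h => h.trans (hpp'.mono hsub).symm⟩

theorem deleteVertices_diff_edgeInterior {G : SimpleGraph V} {X : Set (Point G)} {S : Finset V}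
    {e : G.edgeSet} {v : V} (hv : v ∈ e.1) (hvS : v ∈ S) :
    deleteVertices (X \ edgeInterior e) S = deleteVertices X S := by
  ext p
  rw [mem_deleteVertices, mem_deleteVertices]
  refine ⟨fun h => ⟨h.1.1, h.2⟩, fun h => ⟨⟨h.1, ?_⟩, h.2⟩⟩
  rintro ⟨t, rfl⟩
  exact h.2.2 e t rfl v hv hvS

/-- Separators are trimmed to vertices of `X` because the counting of corner boundaries places each
separator vertex by means of `cover`, which only speaks of such vertices. -/
theorem exists_subset_deleteVertices_eq {G : SimpleGraph V} {X : Set (Point G)}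
    (hX : IsStandardSubspace X) (S : Finset V) :
    ∃ T ⊆ S, (∀ v ∈ T, Point.vertex v ∈ X) ∧ deleteVertices X T = deleteVertices X S := by
  classical
  have hsub := Finset.filter_subset (fun v => Point.vertex v ∈ X) S
  refine ⟨S.filter fun v => Point.vertex v ∈ X, hsub, fun v hv => (Finset.mem_filter.1 hv).2,
    Set.Subset.antisymm (fun p hp => ?_) (deleteVertices_anti X hsub)⟩
  rw [mem_deleteVertices] at hp ⊢
  obtain ⟨hpX, h1, h2⟩ := hp
  refine ⟨hpX, ?_, ?_⟩
  · rintro v hv rfl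
    exact h1 v (Finset.mem_filter.2 ⟨hv, hpX⟩) rfl
  · rintro e t rfl v hv hvS
    have hvX := hX.2 e ⟨_, hpX, t, rfl⟩ (mem_closedEdge_vertex hv)
    exact h2 e t rfl v hv (Finset.mem_filter.2 ⟨hvS, hvX⟩)

/-- The union of the path components of `x` and `y` is finitely invariant and closed under all
adjacencies of `X - S`, including that along `e`; as `X - S` is path-connected, it misses nothing.
-/
theorem joinedIn_or_joinedIn {G : SimpleGraph V} {X : Set (Point G)} (hX : IsStandardSubspace X)
    {S : Finset V} (hS : IsPathConnected (deleteVertices X S)) {e : G.edgeSet} {x y : V}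
    (he : e.1 = s(x, y)) (hx : Point.vertex x ∈ deleteVertices X S) {p : Point G}
    (hp : p ∈ deleteVertices (X \ edgeInterior e) S) :
    JoinedIn (deleteVertices (X \ edgeInterior e) S) (Point.vertex x) p ∨
      JoinedIn (deleteVertices (X \ edgeInterior e) S) (Point.vertex y) p := by
  set D := deleteVertices (X \ edgeInterior e) S
  set W := {p | JoinedIn D (Point.vertex x) p} ∪ {p | JoinedIn D (Point.vertex y) p}
  have hW : FinitelyInvariant X W :=
    (finitelyInvariant_joinedIn X S e _).union (finitelyInvariant_joinedIn X S e _)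
  have hrefl {v : V} (hv : Point.vertex v ∈ X) (hvS : v ∉ S) :
      JoinedIn D (Point.vertex v) (Point.vertex v) := by
    refine JoinedIn.refl (vertex_mem_deleteVertices.2 ⟨⟨hv, ?_⟩, hvS⟩)
    rintro ⟨t, ht⟩
    cases ht
  have hx' := vertex_mem_deleteVertices.1 hx
  have hpW : p ∈ edgeExtension W := by
    refine hW.mem_edgeExtension_of_joinedIn hX ?_ (hS.joinedIn _ hx _ ?_)
      (Or.inl (hrefl hx'.1 hx'.2))
    · intro a b hab haS hbS ha
      by_cases h : e.1 = s(a, b)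
      · rw [he, Sym2.eq_iff] at h
        rcases h with ⟨rfl, rfl⟩ | ⟨rfl, rfl⟩
        · exact Or.inr (hrefl hab.symm.left_mem hbS)
        · exact Or.inl (hrefl hab.symm.left_mem hbS)
      · have hj := joinedIn_of_adjIn (adjIn_diff_edgeInterior hab h) haS hbS
        exact ha.imp (fun h => h.trans hj) fun h => h.trans hj
    · have hp' := mem_deleteVertices.1 hp
      exact mem_deleteVertices.2 ⟨hp'.1.1, hp'.2⟩
  rcases p with v | ⟨f, t⟩ | ω
  · exact hpW
  · have hj := joinedIn_vertex_inner (isStandardSubspace_diff_edgeInterior hX e) hp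
      (out_fst_mem f)
    exact (hpW _ (out_fst_mem f)).imp (fun h => h.trans hj) fun h => h.trans hj
  · exact hpW

theorem exists_edgeSeparation {G : SimpleGraph V} {k : ℕ} {X : Set (Point G)}
    (hX : IsWeaklyConnected k X) {e : G.edgeSet} {x y : V} (he : e.1 = s(x, y))
    (hcrit : ¬ IsWeaklyConnected k (X \ edgeInterior e)) :
    Nonempty (EdgeSeparation X k x y) := by
  classical
  have hX' := isStandardSubspace_diff_edgeInterior hX.1 e
  have hxe : x ∈ e.1 := by rw [he]; exact Sym2.mem_mk_left _ _
  have hye : y ∈ e.1 := by rw [he]; exact Sym2.mem_mk_right _ _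
  have hvert (v : V) : Point.vertex v ∈ X \ edgeInterior e ↔ Point.vertex v ∈ X := by
    refine ⟨fun h => h.1, fun h => ⟨h, ?_⟩⟩
    rintro ⟨t, ht⟩
    cases ht
  -- Otherwise removing the interior of `e` would not change `X`.
  have heX : closedEdge e ⊆ X := by
    by_contra h
    have h' : X \ edgeInterior e = X := by
      refine sdiff_eq_left.2 (Set.disjoint_iff_inter_eq_empty.2 ?_)
      by_contra hne
      exact h (hX.1.2 e (Set.nonempty_iff_ne_empty.2 hne))
    exact hcrit (h'.symm ▸ hX)
  obtain ⟨S', hS', hnot⟩ : ∃ S : Finset V, S.card < k ∧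
      ¬ IsPathConnected (deleteVertices (X \ edgeInterior e) S) := by
    by_contra! hall
    refine hcrit ⟨hX', ?_, hall⟩
    simp only [hvert]
    exact hX.2.1
  obtain ⟨S, hSS', hSX', hSeq⟩ := exists_subset_deleteVertices_eq hX' S'
  rw [← hSeq] at hnot
  have hScard : S.card < k := (Finset.card_le_card hSS').trans_lt hS'
  have hSX : ∀ v ∈ S, Point.vertex v ∈ X := fun v hv => (hvert v).1 (hSX' v hv)
  have hXS := hX.2.2 S hScard
  -- If `S` contained an endpoint of `e`, the interior of `e` would be gone already and `X - S`
  -- would be disconnected.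
  have hnotMem {v : V} (hv : v ∈ e.1) : v ∉ S := fun hvS =>
    hnot (deleteVertices_diff_edgeInterior (X := X) hv hvS ▸ hXS)
  have hx : Point.vertex x ∈ deleteVertices X S :=
    vertex_mem_deleteVertices.2 ⟨heX (mem_closedEdge_vertex hxe), hnotMem hxe⟩
  have hx' : Point.vertex x ∈ deleteVertices (X \ edgeInterior e) S :=
    vertex_mem_deleteVertices.2 ⟨(hvert x).2 (heX (mem_closedEdge_vertex hxe)), hnotMem hxe⟩
  have hy' : Point.vertex y ∈ deleteVertices (X \ edgeInterior e) S :=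
    vertex_mem_deleteVertices.2 ⟨(hvert y).2 (heX (mem_closedEdge_vertex hye)), hnotMem hye⟩
  have hor := @joinedIn_or_joinedIn V G X hX.1 S hXS e x y he hx
  have hxy : ¬ JoinedIn (deleteVertices (X \ edgeInterior e) S)
      (Point.vertex x) (Point.vertex y) := fun h =>
    hnot ⟨_, hx', fun {p} hp => (hor hp).elim id fun h' => h.trans h'⟩
  have hdisj (p : Point G)
      (h1 : JoinedIn (deleteVertices (X \ edgeInterior e) S) (Point.vertex x) p)
      (h2 : JoinedIn (deleteVertices (X \ edgeInterior e) S) (Point.vertex y) p) : False :=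
    hxy (h1.trans h2.symm)
  exact ⟨{
    sep := S
    left := {p | JoinedIn (deleteVertices (X \ edgeInterior e) S) (Point.vertex x) p}
    right := {p | JoinedIn (deleteVertices (X \ edgeInterior e) S) (Point.vertex y) p}
    card_lt := hScard
    sep_subset := hSX
    left_subset := fun p hp => (mem_deleteVertices.1 hp.target_mem).1.1
    right_subset := fun p hp => (mem_deleteVertices.1 hp.target_mem).1.1
    cover := fun v hv => by
      by_cases hvS : v ∈ S
      · exact Or.inr (Or.inr hvS)
      · exact (hor (vertex_mem_deleteVertices.2 ⟨(hvert v).2 hv, hvS⟩)).imp id Or.inl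
    disjoint := fun v h1 h2 => hdisj _ h1 h2
    left_notMem := fun v h => (vertex_mem_deleteVertices.1 h.target_mem).2
    right_notMem := fun v h => (vertex_mem_deleteVertices.1 h.target_mem).2
    mem_left := JoinedIn.refl hx'
    mem_right := JoinedIn.refl hy'
    eq_of_adjIn := fun a b hab ha hb => by
      by_cases h : e.1 = s(a, b)
      · rw [he, Sym2.eq_iff] at h
        rcases h with ⟨rfl, rfl⟩ | ⟨rfl, rfl⟩
        · exact ⟨rfl, rfl⟩
        · exact absurd ha hxy
      · refine (hdisj _ (ha.trans (joinedIn_of_adjIn (adjIn_diff_edgeInterior hab h)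
          ?_ ?_)) hb).elim
        · exact (vertex_mem_deleteVertices.1 ha.target_mem).2
        · exact (vertex_mem_deleteVertices.1 hb.target_mem).2
    left_invariant := finitelyInvariant_joinedIn X S e _
    right_invariant := finitelyInvariant_joinedIn X S e _ }⟩

/-! ### Uncrossing the separations of two consecutive edges. -/

/-- `T` contains the boundary of the corner `left ∩ left`, apart from the edges `xy` and `xz`. So
`T` with `x` would separate any other vertex of the corner from `y`, and has fewer than `k`
elements. Hence `x` is alone there and its neighbours lie in `T`, `y` and `z`. -/
theorem EdgeSeparation.eq_of_card_sep_lt {G : SimpleGraph V} {k : ℕ} {X : Set (Point G)}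
    (hX : IsWeaklyConnected k X) {x y z : V} (s₁ : EdgeSeparation X k x y)
    (s₂ : EdgeSeparation X k x z) {T : Finset V}
    (h₁ : ∀ v ∈ s₁.sep, Point.vertex v ∉ s₂.right → v ∈ T)
    (h₂ : ∀ v ∈ s₂.sep, Point.vertex v ∉ s₁.right → v ∈ T)
    (hy : y ∉ T) (hT : T.card + 1 < k) :
    degreeIn X x = k := by
  classical
  have step {a b : V} (hab : AdjIn X a b) (hax : a ≠ x) (ha₁ : Point.vertex a ∈ s₁.left)
      (ha₂ : Point.vertex a ∈ s₂.left) (hb : b ∉ T) :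
      Point.vertex b ∈ s₁.left ∧ Point.vertex b ∈ s₂.left := by
    have hbX := hab.symm.left_mem
    have hb₁ : Point.vertex b ∉ s₁.right := fun h => hax (s₁.eq_of_adjIn a b hab ha₁ h).1
    have hb₂ : Point.vertex b ∉ s₂.right := fun h => hax (s₂.eq_of_adjIn a b hab ha₂ h).1
    exact ⟨(s₁.cover b hbX).resolve_right (not_or.2 ⟨hb₁, fun h => hb (h₁ b h hb₂)⟩),
      (s₂.cover b hbX).resolve_right (not_or.2 ⟨hb₂, fun h => hb (h₂ b h hb₁)⟩)⟩
  have hyx : y ≠ x := fun h => s₁.disjoint y (h ▸ s₁.mem_left) s₁.mem_right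
  have hcorner (w : V) (hw₁ : Point.vertex w ∈ s₁.left) (hw₂ : Point.vertex w ∈ s₂.left)
      (hwT : w ∉ T) : w = x := by
    by_contra hwx
    refine s₁.disjoint y ((s₁.left_invariant.inter s₂.left_invariant).mem_of_joinedIn hX.1
      (U := insert x T) ?_ (joinedIn_of_isWeaklyConnected hX
        ((Finset.card_insert_le x T).trans_lt hT) (s₁.left_subset hw₁)
        (s₁.right_subset s₁.mem_right) ?_ ?_) ⟨hw₁, hw₂⟩).1 s₁.mem_right
    · intro a b hab ha hb haW
      rw [Finset.mem_insert, not_or] at ha hb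
      exact step hab ha.1 haW.1 haW.2 hb.2
    · exact fun h => (Finset.mem_insert.1 h).elim hwx hwT
    · exact fun h => (Finset.mem_insert.1 h).elim hyx hy
  have hsub : {w | AdjIn X x w} ⊆ (insert y (insert z T) : Finset V) := by
    intro w hw
    have hwX := hw.symm.left_mem
    rw [Finset.mem_coe, Finset.mem_insert, Finset.mem_insert]
    by_contra! hne
    have hw₁ : Point.vertex w ∉ s₁.right := fun h =>
      hne.1 (s₁.eq_of_adjIn x w hw s₁.mem_left h).2
    have hw₂ : Point.vertex w ∉ s₂.right := fun h =>
      hne.2.1 (s₂.eq_of_adjIn x w hw s₂.mem_left h).2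
    exact hw.ne (hcorner w
      ((s₁.cover w hwX).resolve_right (not_or.2 ⟨hw₁, fun h => hne.2.2 (h₁ w h hw₂)⟩))
      ((s₂.cover w hwX).resolve_right (not_or.2 ⟨hw₂, fun h => hne.2.2 (h₂ w h hw₁)⟩))
      hne.2.2).symm
  refine le_antisymm ?_ (le_degreeIn hX (s₁.left_subset s₁.mem_left))
  rw [degreeIn_eq_encard]
  refine (Set.encard_le_encard hsub).trans ?_
  rw [Set.encard_coe_eq_coe_finsetCard]
  have h3 := Finset.card_insert_le y (insert z T)
  have h4 := Finset.card_insert_le z T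
  exact_mod_cast (by omega : (insert y (insert z T)).card ≤ k)

/-- Neither `xy` nor `xz` leaves the corner `right ∩ right`, so its boundary lies in `U`, which is
too small to separate it from `x`. -/
theorem EdgeSeparation.disjoint_right {G : SimpleGraph V} {k : ℕ} {X : Set (Point G)}
    (hX : IsWeaklyConnected k X) {x y z : V} (hyz : y ≠ z) (s₁ : EdgeSeparation X k x y)
    (s₂ : EdgeSeparation X k x z) {U : Finset V}
    (hU : ∀ v ∈ U, v ∈ s₁.sep ∨ v ∈ s₂.sep)
    (hU' : ∀ v ∈ U, Point.vertex v ∉ s₁.right ∨ Point.vertex v ∉ s₂.right)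
    (h₁ : ∀ v ∈ s₁.sep, Point.vertex v ∉ s₂.left → v ∈ U)
    (h₂ : ∀ v ∈ s₂.sep, Point.vertex v ∉ s₁.left → v ∈ U) (hk : U.card < k)
    {w : V} (hw : Point.vertex w ∈ s₁.right) : Point.vertex w ∉ s₂.right := by
  intro hw'
  refine s₁.disjoint x s₁.mem_left ((s₁.right_invariant.inter s₂.right_invariant).mem_of_joinedIn
    hX.1 (U := U) ?_ (joinedIn_of_isWeaklyConnected hX hk (s₁.right_subset hw)
      (s₁.left_subset s₁.mem_left) ?_ ?_) ⟨hw, hw'⟩).1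
  · rintro a b hab ha hb ⟨ha₁, ha₂⟩
    have hbX := hab.symm.left_mem
    have hba := hab.symm
    -- Such an edge is `xy` with `y` also in `s₂.right`; it then crosses `s₂` as well, forcing `y =
    -- z`.
    have hb₁ : Point.vertex b ∉ s₁.left := fun h => by
      obtain ⟨rfl, rfl⟩ := s₁.eq_of_adjIn b a hba h ha₁
      exact hyz (s₂.eq_of_adjIn b a hba s₂.mem_left ha₂).2
    have hb₂ : Point.vertex b ∉ s₂.left := fun h => by
      obtain ⟨rfl, rfl⟩ := s₂.eq_of_adjIn b a hba h ha₂
      exact hyz (s₁.eq_of_adjIn b a hba s₁.mem_left ha₁).2.symm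
    exact ⟨((s₁.cover b hbX).resolve_left hb₁).resolve_right fun h => hb (h₁ b h hb₂),
      ((s₂.cover b hbX).resolve_left hb₂).resolve_right fun h => hb (h₂ b h hb₁)⟩
  · intro h
    rcases hU' w h with h | h
    · exact h hw
    · exact h hw'
  · intro h
    rcases hU x h with h | h
    · exact s₁.left_notMem x s₁.mem_left h
    · exact s₂.left_notMem x s₂.mem_left h

/-- Consecutive critical edges `yx` and `xz` at a vertex `x` whose degree is not `k`: the side of
`z` is smaller than the side of `x` with respect to `yx`, when measured by the difference. -/
theorem EdgeSeparation.encard_diff_lt {G : SimpleGraph V} {k : ℕ} {X : Set (Point G)}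
    (hX : IsWeaklyConnected k X) {x y z : V} (hyz : y ≠ z) (s₁ : EdgeSeparation X k x y)
    (s₂ : EdgeSeparation X k x z) (hdeg : degreeIn X x ≠ k) :
    ({v | Point.vertex v ∈ s₂.right} \ {v | Point.vertex v ∈ s₁.left}).encard <
      ({v | Point.vertex v ∈ s₁.left} \ {v | Point.vertex v ∈ s₂.right}).encard := by
  classical
  set T : Finset V := (s₁.sep.filter fun v => Point.vertex v ∉ s₂.right) ∪
    s₂.sep.filter fun v => Point.vertex v ∉ s₁.right with hT
  set U : Finset V := (s₁.sep.filter fun v => Point.vertex v ∉ s₂.left) ∪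
    s₂.sep.filter fun v => Point.vertex v ∉ s₁.left with hU
  have hTmem (v : V) : v ∈ T ↔ (v ∈ s₁.sep ∧ Point.vertex v ∉ s₂.right) ∨
      (v ∈ s₂.sep ∧ Point.vertex v ∉ s₁.right) := by simp [hT]
  have hUmem (v : V) : v ∈ U ↔ (v ∈ s₁.sep ∧ Point.vertex v ∉ s₂.left) ∨
      (v ∈ s₂.sep ∧ Point.vertex v ∉ s₁.left) := by simp [hU]
  -- Submodularity: `T ∪ U` lies in the union of the separators and `T ∩ U` in their intersection.
  have hsum : T.card + U.card ≤ s₁.sep.card + s₂.sep.card := by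
    rw [← Finset.card_union_add_card_inter T U, ← Finset.card_union_add_card_inter s₁.sep s₂.sep]
    refine Nat.add_le_add (Finset.card_le_card fun v hv => ?_) (Finset.card_le_card fun v hv => ?_)
    · rw [Finset.mem_union, hTmem, hUmem] at hv
      rw [Finset.mem_union]
      tauto
    · rw [Finset.mem_inter, hTmem, hUmem] at hv
      rw [Finset.mem_inter]
      have h1 := s₁.cover v
      have h2 := s₂.cover v
      have h3 := s₁.sep_subset v
      have h4 := s₂.sep_subset v
      tauto
  have hTk : k ≤ T.card + 1 := by
    by_contra! hlt
    refine hdeg (s₁.eq_of_card_sep_lt hX s₂ (fun v h h' => (hTmem v).2 (Or.inl ⟨h, h'⟩))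
      (fun v h h' => (hTmem v).2 (Or.inr ⟨h, h'⟩)) (fun h => ?_) hlt)
    rcases (hTmem y).1 h with h | h
    · exact s₁.right_notMem y s₁.mem_right h.1
    · exact h.2 s₁.mem_right
  have hc₁ := s₁.card_lt
  have hc₂ := s₂.card_lt
  -- `U.card < k`, since `T` has at least `k - 1` elements and the two separators together at most
  -- `2k - 2`.
  have hdisj {w : V} (hw : Point.vertex w ∈ s₁.right) : Point.vertex w ∉ s₂.right := by
    refine s₁.disjoint_right hX hyz s₂ (U := U) (fun v hv => ?_) (fun v hv => ?_)
      (fun v h h' => (hUmem v).2 (Or.inl ⟨h, h'⟩)) (fun v h h' => (hUmem v).2 (Or.inr ⟨h, h'⟩))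
      (by omega) hw
    · exact ((hUmem v).1 hv).imp And.left And.left
    · exact ((hUmem v).1 hv).imp (fun h h' => s₁.right_notMem v h' h.1)
        fun h h' => s₂.right_notMem v h' h.1
  set P := s₁.sep.filter fun v => Point.vertex v ∈ s₂.right with hP
  set Q := s₂.sep.filter fun v => Point.vertex v ∈ s₁.left with hQ
  -- `T` is covered by `s₁.sep` minus `P` together with `Q`, and has at least as many elements as
  -- `s₁.sep`.
  have hPQ : P.card ≤ Q.card := by
    have h1 : T.card ≤ (s₁.sep.filter fun v => Point.vertex v ∉ s₂.right).card + Q.card := by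
      refine le_trans (Finset.card_le_card fun v hv => ?_) (Finset.card_union_le _ _)
      rw [hTmem] at hv
      simp only [hQ, Finset.mem_union, Finset.mem_filter]
      have h1 := s₁.cover v
      have h2 := s₂.sep_subset v
      have h3 := s₂.right_notMem v
      tauto
    have h2 := Finset.card_filter_add_card_filter_not (s := s₁.sep)
      (fun v => Point.vertex v ∈ s₂.right)
    rw [← hP] at h2
    omega
  have hxQ : x ∉ Q := fun h => s₂.left_notMem x s₂.mem_left (Finset.mem_filter.1 h).1
  -- As the two right sides share no vertex, `s₂.right` leaves `s₁.left` only into `P`. In the other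
  -- direction `x` comes in addition to `Q`, making the inequality strict.
  calc _ ≤ (P : Set V).encard := by
        refine Set.encard_le_encard fun v hv => ?_
        have hv' : Point.vertex v ∈ s₂.right := hv.1
        refine Finset.mem_coe.2 (Finset.mem_filter.2 ⟨?_, hv'⟩)
        exact ((s₁.cover v (s₂.right_subset hv')).resolve_left hv.2).resolve_left
          fun h => hdisj h hv'
    _ < ((insert x Q : Finset V) : Set V).encard := by
        rw [Set.encard_coe_eq_coe_finsetCard, Set.encard_coe_eq_coe_finsetCard,
          Finset.card_insert_of_notMem hxQ]
        exact_mod_cast Nat.lt_succ_of_le hPQ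
    _ ≤ _ := by
        refine Set.encard_le_encard fun v hv => ?_
        rcases Finset.mem_insert.1 (Finset.mem_coe.1 hv) with rfl | hv
        · exact ⟨s₁.mem_left, s₂.disjoint v s₂.mem_left⟩
        · rw [Finset.mem_filter] at hv
          exact ⟨hv.2, fun h => s₂.right_notMem v h hv.1⟩

/-! ### Going around the cycle. -/

/-- There is no cyclic sequence of sets in which each set is smaller than its predecessor, as
measured by the difference. -/
theorem false_of_encard_diff_lt {D : ℕ → Set V} {n : ℕ} (hn : 0 < n)
    (hper : ∀ i, D (i + n) = D i)
    (hD : ∀ i, (D (i + 1) \ D i).encard < (D i \ D (i + 1)).encard) : False := by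
  have hfin (i j : ℕ) : (D (i + j) \ D i).Finite := by
    induction j with
    | zero => simp
    | succ j ih =>
      refine ((Set.encard_lt_top_iff.1 ((hD (i + j)).trans_le le_top)).union ih).subset ?_
      rintro v ⟨h1, h2⟩
      by_cases h : v ∈ D (i + j)
      · exact Or.inr ⟨h, h2⟩
      · exact Or.inl ⟨h1, h⟩
  -- Going on around the cycle from `i + 1` leads back to `D i` after `n - 1` steps.
  have hfin' (i : ℕ) : (D i \ D (i + 1)).Finite := by
    have h := hfin (i + 1) (n - 1)
    rwa [show i + 1 + (n - 1) = i + n by omega, hper] at h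
  -- The sets may be infinite, but all changes take place in the finite set `K`, where cardinalities
  -- can be compared.
  set K : Set V := ⋃ i ∈ Finset.range n, (D (i + 1) \ D i) ∪ (D i \ D (i + 1)) with hK
  have hKfin : K.Finite := Set.Finite.biUnion (Finset.range n).finite_toSet
    fun i _ => (hfin i 1).union (hfin' i)
  have hlt (i : ℕ) (hi : i < n) : (D (i + 1) ∩ K).ncard < (D i ∩ K).ncard := by
    have hsub : (D (i + 1) \ D i) ∪ (D i \ D (i + 1)) ⊆ K :=
      Set.subset_biUnion_of_mem (u := fun i => (D (i + 1) \ D i) ∪ (D i \ D (i + 1)))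
        (Finset.mem_coe.2 (Finset.mem_range.2 hi))
    have hf (j : ℕ) : (D j ∩ K).Finite := hKfin.subset Set.inter_subset_right
    have hdiff (A B : Set V) (h : A \ B ⊆ K) : (A ∩ K) \ (B ∩ K) = A \ B := by
      ext v
      have := @h v
      simp only [Set.mem_sdiff, Set.mem_inter_iff] at this ⊢
      tauto
    rw [Set.ncard_lt_ncard_iff_ncard_sdiff_lt_ncard_sdiff (hf _) (hf _),
      hdiff _ _ (Set.subset_union_left.trans hsub), hdiff _ _ (Set.subset_union_right.trans hsub)]
    have := hD i
    rw [← (hfin i 1).cast_ncard_eq, ← (hfin' i).cast_ncard_eq] at this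
    exact_mod_cast this
  have hle : ∀ i ≤ n, (D i ∩ K).ncard + i ≤ (D 0 ∩ K).ncard := by
    intro i
    induction i with
    | zero => simp
    | succ i ih =>
      intro hi
      have h1 := ih (by omega)
      have h2 := hlt i (by omega)
      omega
  have h := hle n le_rfl
  rw [show D n = D 0 by simpa using hper 0] at h
  omega

end GraphSpace

theorem mainTheorem4 {V : Type*} (G : SimpleGraph V) (k : ℕ) (hk : 2 ≤ k)
    (X : Set (GraphSpace.Point G)) (hX : GraphSpace.IsWeaklyConnected k X)
    {u : V} (C : G.Walk u u) (hC : C.IsCycle)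
    (hmin : ∀ e : G.edgeSet, e.1 ∈ C.edges →
      ¬ GraphSpace.IsWeaklyConnected k (X \ GraphSpace.edgeInterior e)) :
    ∃ v ∈ C.support, GraphSpace.degreeIn X v = (k : ℕ∞) := by
  by_contra! hdeg
  have hsep (a b : V) (hab : s(a, b) ∈ C.edges) :
      Nonempty (GraphSpace.EdgeSeparation X k a b) :=
    GraphSpace.exists_edgeSeparation hX (e := ⟨s(a, b), C.edges_subset_edgeSet hab⟩) rfl
      (hmin _ hab)
  have s := fun a b hab => (hsep a b hab).some
  have h3 := hC.three_le_length
  set n := C.length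
  set x : ℕ → V := fun i => C.getVert (i % n) with hx
  have hsucc (i : ℕ) : x (i + 1) = C.getVert (i % n + 1) := by
    have hi : i % n < n := Nat.mod_lt _ (by omega)
    rcases Nat.lt_or_ge (i % n + 1) n with h | h
    · rw [hx]
      dsimp only
      rw [Nat.add_mod, Nat.mod_eq_of_lt (by omega : 1 < n), Nat.mod_eq_of_lt h]
    · have h' : i % n + 1 = n := by omega
      rw [h', C.getVert_length, hx]
      dsimp only
      rw [Nat.add_mod, Nat.mod_eq_of_lt (by omega : 1 < n), h', Nat.mod_self, C.getVert_zero]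
  have hedge (i : ℕ) : s(x i, x (i + 1)) ∈ C.edges := by
    rw [hsucc]
    exact C.mk_mem_edges_iff_exists.2 ⟨_, Nat.mod_lt _ (by omega), rfl⟩
  -- This uses that the length is at least 3, so that 2 is nonzero modulo `n`.
  have hne (i : ℕ) : x i ≠ x (i + 2) := by
    intro h
    have h' := hC.getVert_injOn' (Nat.le_sub_one_of_lt (Nat.mod_lt i (by omega)))
      (Nat.le_sub_one_of_lt (Nat.mod_lt (i + 2) (by omega))) h
    have h2 : (i + 0) % n = (i + 2) % n := h'
    have h4 := Nat.ModEq.add_left_cancel' i h2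
    rw [Nat.ModEq, Nat.mod_eq_of_lt (by omega : 0 < n), Nat.mod_eq_of_lt (by omega : 2 < n)] at h4
    omega
  refine GraphSpace.false_of_encard_diff_lt (n := n)
    (D := fun i => {v | GraphSpace.Point.vertex v ∈ (s _ _ (hedge i)).right}) (by omega) ?_ ?_
  · intro i
    have hp (j : ℕ) : x (j + n) = x j := by
      rw [hx]
      dsimp only
      rw [Nat.add_mod_right]
    have h1 : x (i + n + 1) = x (i + 1) := by rw [Nat.add_right_comm, hp]
    -- Separations are chosen per ordered pair of endpoints, so the sides repeat with period `n`.
    have key (a b a' b' : V) (ha : a = a') (hb : b = b') (h : s(a, b) ∈ C.edges)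
        (h' : s(a', b') ∈ C.edges) :
        {v | GraphSpace.Point.vertex v ∈ (s a b h).right} =
          {v | GraphSpace.Point.vertex v ∈ (s a' b' h').right} := by
      subst ha hb
      rfl
    exact key _ _ _ _ (hp i) h1 _ _
  · intro i
    -- After the swap, both separations have the common vertex `x (i + 1)` on their left, and that
    -- left side of the first is `D i`.
    exact (s _ _ (hedge i)).swap.encard_diff_lt hX (hne i) (s _ _ (hedge (i + 1)))
      (hdeg _ (C.getVert_mem_support _))
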